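/- Let $G=(V,E)$ be a simple locally finite graph, i.e. every vertex $v$ has a finite degree $d_v$ ($V$ may be infinite). Let $d(u,v)$ be the graph distance, $N(v)$ the set of neighbours of $v$, and $N[v]=N(v)\cup\{v\}$. A mass distribution of finite support is a map $m:V\to[0,\infty)$ with finite support. A coupling between mass distributions $m_1,m_2$ is a map $A:V\times V\to[0,\infty)$ with $\sum_{v}A(u,v)=m_1(u)$ for all $u$ and $\sum_{u}A(u,v)=m_2(v)$ for all $v$. Its cost is $C(A)=\sum_{u,v}A(u,v)\,d(u,v)$, and $W(m_1,m_2)=\inf_A C(A)$ over all couplings $A$ between $m_1$ and $m_2$. For $0\le\alpha<1$ and a non-isolated vertex $v$ let $m_v^\alpha(v)=\alpha$, $m_v^\alpha(u)=(1-\alpha)/d_v$ for $u\in N(v)$, and $m_v^\alpha(u)=0$ otherwise. For an edge $xy$ (so $d(x,y)=1$) put $\kappa_\alpha(x,y)=1-W(m_x^\alpha,m_y^\alpha)/d(x,y)$. The Lin–Lu–Yau curvature is $\kappa(x,y)=\lim_{\alpha\to1^-}\kappa_\alpha(x,y)/(1-\alpha)$. Let $xy\in E$ with $d_x\le d_y$,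 and let $c_x,c_y$ be the coprime positive integers with $\operatorname{lcm}(d_x,d_y)=c_xd_x=c_yd_y$ (so $c_x\ge c_y$). Define $$\mu_x(u)=\begin{cases}c_x-c_y&u\in N(x)\cap N[y],\\ c_x&u\in N(x)\setminus N[y],\\ 0&\text{otherwise,}\end{cases}\qquad \mu_y(u)=\begin{cases}c_y&u\in N(y)\setminus N[x],\\ 0&\text{otherwise.}\end{cases}$$ Then the limit defining $\kappa(x,y)$ exists, the minimum of $C(\sigma)$ over all integer-valued couplings $\sigma$ between $\mu_x$ and $\mu_y$ is attained, and $$\kappa(x,y)=1+\frac1{d_y}-\frac{\min_\sigma C(\sigma)}{\operatorname{lcm}(d_x,d_y)} .$$ Equivalently, let $X$ consist of $c_x-c_y$ copies of each $u\in N(x)\cap N[y]$ and $c_x$ copies of each $u\in N(x)\setminus N[y]$, let $Y$ consist of $c_y$ copies of each $v\in N(y)\setminus N[x]$, and let $H$ be the complete bipartite graph with sides $X$ and $Y$, where an edge between a copy of $u$ and a copy of $v$ has weight $d(u,v)$. Then $H$ has a perfect matching, and the minimum total weight of a perfect matching of $H$ equals $\min_\sigma C(\sigma)$. -/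

import Mathlib

open Filter Topology

namespace LLY

variable {V : Type*}

/-- `A` is a coupling between the mass distributions `m₁` and `m₂`: it is nonnegative and has
marginals `m₁` and `m₂`.  Since `A u v ≤ m₁ u` and `A u v ≤ m₂ v` follow, a coupling of
distributions of finite support has finite support, and a coupling of probability
distributions takes its values in `[0, 1]`. -/
structure IsCoupling (m₁ m₂ : V → ℝ) (A : V → V → ℝ) : Prop where
  nonneg : ∀ u v, 0 ≤ A u v
  fst : ∀ u, HasSum (fun v => A u v) (m₁ u)
  snd : ∀ v, HasSum (fun u => A u v) (m₂ v)

/-- The cost `∑ A(u, v) d(u, v)` of a coupling. -/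
noncomputable def cost (G : SimpleGraph V) (A : V → V → ℝ) : ℝ :=
  ∑' p : V × V, A p.1 p.2 * (G.dist p.1 p.2 : ℝ)

/-- The transportation distance: the infimum of the costs of the couplings. -/
noncomputable def transportDist (G : SimpleGraph V) (m₁ m₂ : V → ℝ) : ℝ :=
  sInf {c : ℝ | ∃ A : V → V → ℝ, IsCoupling m₁ m₂ A ∧ c = cost G A}

open Classical in
/-- The `α`-lazy random walk started at `x`. -/
noncomputable def lazyWalk (G : SimpleGraph V) [G.LocallyFinite] (α : ℝ) (x v : V) : ℝ :=
  if v = x then α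
  else if G.Adj x v then (1 - α) / (G.degree x : ℝ)
  else 0

/-- The `α`-Ricci curvature. -/
noncomputable def alphaCurvature (G : SimpleGraph V) [G.LocallyFinite] (α : ℝ) (x y : V) : ℝ :=
  1 - transportDist G (lazyWalk G α x) (lazyWalk G α y) / (G.dist x y : ℝ)

/-- The Lin–Lu–Yau curvature: the limit of `κ_α(x, y) / (1 - α)` as `α` tends to `1` from below. -/
noncomputable def curvature (G : SimpleGraph V) [G.LocallyFinite] (x y : V) : ℝ :=
  limUnder (𝓝[<] (1 : ℝ)) (fun α : ℝ => alphaCurvature G α x y / (1 - α))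

open Classical in
/-- The closed neighbourhood `N[v]`. -/
noncomputable def closedNbhd (G : SimpleGraph V) [G.LocallyFinite] (v : V) : Finset V :=
  insert v (G.neighborFinset v)

open Classical in
/-- The set `N(y) \ N[x]`. -/
noncomputable def privateNbhd (G : SimpleGraph V) [G.LocallyFinite] (x y : V) : Finset V :=
  G.neighborFinset y \ closedNbhd G x

open Classical in
/-- The mass distribution `μ_x`. -/
noncomputable def muX (G : SimpleGraph V) [G.LocallyFinite] (x y : V) (cx cy : ℕ) (u : V) : ℝ :=
  if u ∈ G.neighborFinset x ∩ closedNbhd G y then (cx : ℝ) - (cy : ℝ)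
  else if u ∈ G.neighborFinset x \ closedNbhd G y then (cx : ℝ)
  else 0

open Classical in
/-- The mass distribution `μ_y`. -/
noncomputable def muY (G : SimpleGraph V) [G.LocallyFinite] (x y : V) (cy : ℕ) (u : V) : ℝ :=
  if u ∈ privateNbhd G x y then (cy : ℝ) else 0

open Classical in
/-- The number of copies of `u` in the blow-up set `S_u`, for `u ∈ N(x) ∪ N(y)`.  It is used
only for `cy ≤ cx`, so that the subtraction is not truncated. -/
noncomputable def blowupSize (G : SimpleGraph V) [G.LocallyFinite] (x y : V) (cx cy : ℕ)
    (u : V) : ℕ :=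
  if u = x then 0
  else if u ∈ G.neighborFinset x ∩ closedNbhd G y then cx - cy
  else if u ∈ G.neighborFinset x \ closedNbhd G y then cx
  else if u ∈ privateNbhd G x y then cy
  else 0

/-- The blow-up `X`, the disjoint union of the sets `S_u` over `u ∈ N(x)`. -/
abbrev BlowupX (G : SimpleGraph V) [G.LocallyFinite] (x y : V) (cx cy : ℕ) : Type _ :=
  Σ u : {u : V // u ∈ G.neighborFinset x}, Fin (blowupSize G x y cx cy u.1)

/-- The blow-up `Y`, the disjoint union of the sets `S_v` over `v ∈ N(y) \ N[x]`. -/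
abbrev BlowupY (G : SimpleGraph V) [G.LocallyFinite] (x y : V) (cx cy : ℕ) : Type _ :=
  Σ v : {v : V // v ∈ privateNbhd G x y}, Fin (blowupSize G x y cx cy v.1)

/-- The complete bipartite graph `H` with sides `X` and `Y`. -/
abbrev blowupGraph (G : SimpleGraph V) [G.LocallyFinite] (x y : V) (cx cy : ℕ) :
    SimpleGraph (BlowupX G x y cx cy ⊕ BlowupY G x y cx cy) :=
  completeBipartiteGraph (BlowupX G x y cx cy) (BlowupY G x y cx cy)

open Classical in
/-- The total weight of the edges of a subgraph `M` of `H`, where the edge between a copy of `u`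
and a copy of `v` has weight `d(u, v)`. -/
noncomputable def weight (G : SimpleGraph V) [G.LocallyFinite] (x y : V) (cx cy : ℕ)
    (M : (blowupGraph G x y cx cy).Subgraph) : ℝ :=
  ∑ a : BlowupX G x y cx cy, ∑ b : BlowupY G x y cx cy,
    if M.Adj (Sum.inl a) (Sum.inr b) then (G.dist a.1.1 b.1.1 : ℝ) else 0

end LLY

/-! ### Integral duality and the Kantorovich potential. -/

namespace LLY

/-! Put `L = lcm`, `t = (1 - α) / L`, `s = α - t * cy`. Up to the factor `t`, the two lazy walks are
`μ_x` and `μ_y` plus a common stationary mass, with a further mass `s` at `x`, respectively at `y`.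
Keeping the common mass fixed, moving `s` along `xy` and using an optimal matching for the rest
costs `t * C + s`.

This is optimal if some potential for `μ_x`, `μ_y` also has gradient 1 along `xy`. Duality for the
assignment problem gives prices `q` on `Y`; set `f z = min_b (q b + d(b, z))`. This is 1-Lipschitz
and tight on matched pairs, and since every `b ∈ N(y) \ N[x]` has distance 2 from `x` and 1 from
`y`, it satisfies `f x - f y = 1`. Hence `κ_α / (1 - α)` is constant for `α` near 1. The same `f`
bounds all couplings and all perfect matchings from below, so both minima equal `C`. -/

/-- Linear programming duality for the assignment problem with integral costs. -/
theorem exists_equiv_tight_potentials {X Y : Type*} [Fintype X] [Fintype Y]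
    (hcard : Fintype.card X = Fintype.card Y) (c : X → Y → ℕ) :
    ∃ (π : X ≃ Y) (p : X → ℤ) (q : Y → ℤ), (∀ a b, p a - q b ≤ c a b) ∧
      ∀ a, p a - q (π a) = c a (π a) := by
  classical
  obtain ⟨e⟩ := Fintype.card_eq.mp hcard
  obtain ⟨n, ⟨p, q, hpq, hn⟩, hmax⟩ := Int.exists_greatest_of_bdd
    (P := fun n => ∃ (p : X → ℤ) (q : Y → ℤ), (∀ a b, p a - q b ≤ c a b) ∧
      n = ∑ a, p a - ∑ b, q b)
    ⟨∑ a, (c a (e a) : ℤ), by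
      rintro _ ⟨p, q, h, rfl⟩
      rw [← Equiv.sum_comp e q, ← Finset.sum_sub_distrib]
      exact Finset.sum_le_sum fun a _ => h a (e a)⟩
    ⟨_, 0, 0, by simp, rfl⟩
  let t : X → Finset Y := fun a => Finset.univ.filter fun b => p a - q b = c a b
  have hall : ∀ s : Finset X, s.card ≤ (s.biUnion t).card := by
    intro s
    -- Raising `p` on `s` and `q` on its tight neighbours changes the dual value by `s.card -
    -- (s.biUnion t).card`, so maximality yields Hall's condition.
    have := hmax _ ⟨fun a => p a + if a ∈ s then 1 else 0,
      fun b => q b + if b ∈ s.biUnion t then 1 else 0, ?_, rfl⟩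
    · simp only [Finset.sum_add_distrib, Finset.sum_boole, Finset.filter_univ_mem] at this
      lia
    · intro a b
      have h := hpq a b
      by_cases ha : a ∈ s
      · by_cases hb : b ∈ s.biUnion t
        · simp only [ha, hb, if_true]; lia
        -- Integrality: a pair that is not tight has slack at least 1.
        · have : ¬ p a - q b = c a b := fun h' =>
            hb (Finset.mem_biUnion.2 ⟨a, ha, by simp [t, h']⟩)
          simp only [ha, hb, if_true, if_false]; lia
      · simp only [ha, if_false]
        split_ifs <;> lia
  obtain ⟨g, hg, hgt⟩ := (Finset.all_card_le_biUnion_card_iff_exists_injective t).1 hall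
  refine ⟨Equiv.ofBijective g ((Fintype.bijective_iff_injective_and_card g).2 ⟨hg, hcard⟩),
    p, q, hpq, fun a => ?_⟩
  simpa [t] using hgt a

variable {V : Type*} {G : SimpleGraph V}

theorem IsCoupling.eq_zero_of_fst {m₁ m₂ : V → ℝ} {A : V → V → ℝ} (h : IsCoupling m₁ m₂ A)
    {u : V} (hu : m₁ u = 0) (v : V) : A u v = 0 :=
  congrFun ((hasSum_zero_iff_of_nonneg (h.nonneg u)).1 (hu ▸ h.fst u)) v

theorem IsCoupling.eq_zero_of_snd {m₁ m₂ : V → ℝ} {A : V → V → ℝ} (h : IsCoupling m₁ m₂ A)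
    {v : V} (hv : m₂ v = 0) (u : V) : A u v = 0 :=
  congrFun ((hasSum_zero_iff_of_nonneg fun u => h.nonneg u v).1 (hv ▸ h.snd v)) u

/-- Weak Kantorovich duality. -/
theorem IsCoupling.sum_potential_le_cost {m₁ m₂ : V → ℝ} {A : V → V → ℝ}
    (h : IsCoupling m₁ m₂ A) {S : Finset V} (h₁ : ∀ u ∉ S, m₁ u = 0) (h₂ : ∀ u ∉ S, m₂ u = 0)
    {f : V → ℝ} (hf : ∀ u ∈ S, ∀ v ∈ S, f u - f v ≤ G.dist u v) :
    ∑ u ∈ S, f u * m₁ u - ∑ u ∈ S, f u * m₂ u ≤ cost G A := by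
  have e₁ : ∀ u, m₁ u = ∑ v ∈ S, A u v := fun u =>
    (h.fst u).unique (hasSum_sum_of_ne_finset_zero fun v hv => h.eq_zero_of_snd (h₂ v hv) u)
  have e₂ : ∀ v, m₂ v = ∑ u ∈ S, A u v := fun v =>
    (h.snd v).unique (hasSum_sum_of_ne_finset_zero fun u hu => h.eq_zero_of_fst (h₁ u hu) v)
  have hc : cost G A = ∑ u ∈ S, ∑ v ∈ S, A u v * G.dist u v := by
    rw [cost, tsum_eq_sum (s := S ×ˢ S), Finset.sum_product]
    rintro ⟨u, v⟩ huv
    rw [Finset.mem_product, not_and_or] at huv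
    rcases huv with hu | hv
    · simp [h.eq_zero_of_fst (h₁ u hu)]
    · simp [h.eq_zero_of_snd (h₂ v hv)]
  simp_rw [e₁, e₂, hc, Finset.mul_sum]
  rw [Finset.sum_comm (f := fun i j => f i * A j i), ← Finset.sum_sub_distrib]
  refine Finset.sum_le_sum fun u hu => ?_
  rw [← Finset.sum_sub_distrib]
  refine Finset.sum_le_sum fun v hv => ?_
  rw [← sub_mul, mul_comm]
  exact mul_le_mul_of_nonneg_left (hf u hu v hv) (h.nonneg u v)

variable [G.LocallyFinite] {x y : V}

theorem mem_closedNbhd {u v : V} : u ∈ closedNbhd G v ↔ u = v ∨ G.Adj v u := by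
  simp [closedNbhd]

theorem mem_privateNbhd {v : V} : v ∈ privateNbhd G x y ↔ G.Adj y v ∧ v ≠ x ∧ ¬ G.Adj x v := by
  simp [privateNbhd, mem_closedNbhd]

theorem dist_eq_two_of_mem_privateNbhd (hxy : G.Adj x y) {v : V} (hv : v ∈ privateNbhd G x y) :
    G.dist v x = 2 := by
  obtain ⟨h, hne, hna⟩ := mem_privateNbhd.1 hv
  have h1 : G.dist v x ≤ 1 + 1 := by
    have := h.symm.reachable.dist_triangle_left x
    rwa [SimpleGraph.dist_eq_one_iff_adj.2 h.symm,
      SimpleGraph.dist_eq_one_iff_adj.2 hxy.symm] at this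
  have h2 : G.dist v x ≠ 0 := fun h0 =>
    hne (((h.symm.reachable.trans hxy.symm.reachable).dist_eq_zero_iff).1 h0)
  have h3 : G.dist v x ≠ 1 := fun h0 => hna (SimpleGraph.dist_eq_one_iff_adj.1 h0).symm
  lia

/-- An optimal matching between the blow-ups together with an optimal Kantorovich potential whose
gradient along the edge `xy` is extremal. -/
theorem exists_equiv_lipschitz_potential (hxy : G.Adj x y) {cx cy : ℕ}
    (hcard : Fintype.card (BlowupX G x y cx cy) = Fintype.card (BlowupY G x y cx cy)) :
    ∃ (π : BlowupX G x y cx cy ≃ BlowupY G x y cx cy) (f : V → ℝ),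
      (∀ u v, G.Reachable x u → G.Reachable x v → f u - f v ≤ G.dist u v) ∧
      f x - f y = 1 ∧ ∀ a, f a.1.1 - f (π a).1.1 = G.dist a.1.1 (π a).1.1 := by
  obtain ⟨π, p, q, hpq, htight⟩ := exists_equiv_tight_potentials hcard
    fun a b => G.dist a.1.1 b.1.1
  -- `G.dist` is 0 between components, hence the reachability hypotheses. Tightness needs only `≥`,
  -- the Lipschitz bound being the converse.
  suffices ∃ f : V → ℤ, (∀ u v, G.Reachable x u → G.Reachable x v → f u - f v ≤ G.dist u v) ∧
      f x - f y = 1 ∧ ∀ a, (G.dist a.1.1 (π a).1.1 : ℤ) ≤ f a.1.1 - f (π a).1.1 by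
    obtain ⟨f, h1, h2, h3⟩ := this
    refine ⟨π, fun v => f v, fun u v hu hv => ?_, ?_, fun a => ?_⟩ <;> beta_reduce
    · exact_mod_cast h1 u v hu hv
    · exact_mod_cast h2
    have ha : G.Adj x a.1.1 := (G.mem_neighborFinset x a.1.1).1 a.1.2
    have hb := mem_privateNbhd.1 (π a).1.2
    exact_mod_cast le_antisymm (h1 _ _ ha.reachable (hxy.reachable.trans hb.1.reachable)) (h3 a)
  have hreach : ∀ b : BlowupY G x y cx cy, G.Reachable x b.1.1 := fun b =>
    hxy.reachable.trans (mem_privateNbhd.1 b.1.2).1.reachable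
  rcases isEmpty_or_nonempty (BlowupY G x y cx cy) with hY | hY
  -- With nothing to match, the minimum over `Y` is undefined and the distance to `y` serves
  -- instead.
  · refine ⟨fun v => G.dist v y, fun u v hu hv => ?_, ?_, fun a => isEmptyElim (π a)⟩
    · have := (hu.symm.trans hv).dist_triangle_left y
      lia
    · simp [SimpleGraph.dist_eq_one_iff_adj.2 hxy]
  · let f : V → ℤ := fun z => Finset.univ.inf' Finset.univ_nonempty
      fun b : BlowupY G x y cx cy => q b + G.dist b.1.1 z
    have hle : ∀ z b, f z ≤ q b + G.dist b.1.1 z := fun z b =>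
      Finset.inf'_le _ (Finset.mem_univ b)
    have hex : ∀ z, ∃ b, f z = q b + G.dist b.1.1 z := fun z => by
      obtain ⟨b, -, hb⟩ := Finset.exists_mem_eq_inf' Finset.univ_nonempty
        fun b : BlowupY G x y cx cy => q b + G.dist b.1.1 z
      exact ⟨b, hb⟩
    have hx : ∀ b : BlowupY G x y cx cy, G.dist b.1.1 x = 2 := fun b =>
      dist_eq_two_of_mem_privateNbhd hxy b.1.2
    have hy : ∀ b : BlowupY G x y cx cy, G.dist b.1.1 y = 1 := fun b =>
      SimpleGraph.dist_eq_one_iff_adj.2 (mem_privateNbhd.1 b.1.2).1.symm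
    refine ⟨f, fun u v hu hv => ?_, ?_, fun a => ?_⟩
    · obtain ⟨b, hb⟩ := hex v
      have h1 := hle u b
      have h2 := ((hreach b).symm.trans hv).dist_triangle_left u
      rw [G.dist_comm (u := v)] at h2
      lia
    · obtain ⟨b, hb⟩ := hex x
      obtain ⟨b', hb'⟩ := hex y
      have h1 := hle x b'
      have h2 := hle y b
      have := hx b; have := hx b'; have := hy b; have := hy b'
      lia
    -- Feasibility gives `f a ≥ p a`, and taking `b = π a` in the minimum gives `f (π a) ≤ q (π a)`.
    · obtain ⟨b, hb⟩ := hex a.1.1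
      have h1 := hpq a b
      have h2 := htight a
      have h3 := hle (π a).1.1 (π a)
      rw [G.dist_comm] at h1
      rw [G.dist_self] at h3
      lia

end LLY

/-! ### Blow-ups, matchings and integral couplings. -/

namespace LLY

variable {V : Type*} {G : SimpleGraph V}

theorem IsCoupling.finite_support {m₁ m₂ : V → ℝ} {A : V → V → ℝ} (h : IsCoupling m₁ m₂ A)
    {S : Finset V} (h₁ : ∀ u ∉ S, m₁ u = 0) (h₂ : ∀ u ∉ S, m₂ u = 0) :
    (Function.support fun p : V × V => A p.1 p.2).Finite := by
  refine (S ×ˢ S).finite_toSet.subset fun p hp => ?_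
  rw [Finset.mem_coe, Finset.mem_product]
  by_contra hS
  rw [not_and_or] at hS
  exact hp (hS.elim (fun hu => h.eq_zero_of_fst (h₁ _ hu) _)
    fun hv => h.eq_zero_of_snd (h₂ _ hv) _)

theorem IsCoupling.hasSum_cost {m₁ m₂ : V → ℝ} {A : V → V → ℝ} (h : IsCoupling m₁ m₂ A)
    {S : Finset V} (h₁ : ∀ u ∉ S, m₁ u = 0) (h₂ : ∀ u ∉ S, m₂ u = 0) :
    HasSum (fun p : V × V => A p.1 p.2 * (G.dist p.1 p.2 : ℝ)) (cost G A) :=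
  (summable_of_hasFiniteSupport ((h.finite_support h₁ h₂).subset
    (Function.support_mul_subset_left _ _))).hasSum

variable [G.LocallyFinite] {x y : V} {cx cy : ℕ}

theorem muX_eq_zero {u : V} (hu : u ∉ G.neighborFinset x) : muX G x y cx cy u = 0 := by
  classical
  rw [muX, if_neg fun h => hu (Finset.mem_inter.1 h).1,
    if_neg fun h => hu (Finset.mem_sdiff.1 h).1]

theorem muY_eq_zero {u : V} (hu : u ∉ privateNbhd G x y) : muY G x y cy u = 0 :=
  if_neg hu

theorem cast_blowupSize_of_mem_neighborFinset (hle : cy ≤ cx) {u : V}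
    (hu : u ∈ G.neighborFinset x) : (blowupSize G x y cx cy u : ℝ) = muX G x y cx cy u := by
  have hux : u ≠ x := by rintro rfl; simp at hu
  have h : u ∉ privateNbhd G x y := fun h =>
    (mem_privateNbhd.1 h).2.2 ((G.mem_neighborFinset x u).1 hu)
  rw [blowupSize, muX, if_neg hux, if_neg h]
  split_ifs <;> simp [hle]

theorem cast_blowupSize_of_mem_privateNbhd {u : V}
    (hu : u ∈ privateNbhd G x y) : (blowupSize G x y cx cy u : ℝ) = muY G x y cy u := by
  obtain ⟨-, hux, hna⟩ := mem_privateNbhd.1 hu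
  simp [blowupSize, muY, hux, hu, hna]

theorem sum_blowupX (hle : cy ≤ cx) {S : Finset V} (hS : G.neighborFinset x ⊆ S) (g : V → ℝ) :
    ∑ a : BlowupX G x y cx cy, g a.1.1 = ∑ u ∈ S, g u * muX G x y cx cy u := by
  rw [Fintype.sum_sigma, ← Finset.sum_subset hS fun u _ hu => by rw [muX_eq_zero hu, mul_zero],
    ← Finset.sum_coe_sort (G.neighborFinset x)]
  refine Finset.sum_congr rfl fun u _ => ?_
  dsimp only
  rw [Finset.sum_const, Finset.card_univ, Fintype.card_fin, nsmul_eq_mul, mul_comm,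
    cast_blowupSize_of_mem_neighborFinset hle u.2]

theorem sum_blowupY {S : Finset V} (hS : privateNbhd G x y ⊆ S) (g : V → ℝ) :
    ∑ b : BlowupY G x y cx cy, g b.1.1 = ∑ u ∈ S, g u * muY G x y cy u := by
  rw [Fintype.sum_sigma, ← Finset.sum_subset hS fun u _ hu => by rw [muY_eq_zero hu, mul_zero],
    ← Finset.sum_coe_sort (privateNbhd G x y)]
  refine Finset.sum_congr rfl fun u _ => ?_
  dsimp only
  rw [Finset.sum_const, Finset.card_univ, Fintype.card_fin, nsmul_eq_mul, mul_comm,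
    cast_blowupSize_of_mem_privateNbhd u.2]

open Classical in
/-- The number of matched pairs of copies of `u` and `v`. -/
noncomputable def matchingCoupling (π : BlowupX G x y cx cy ≃ BlowupY G x y cx cy) (u v : V) : ℤ :=
  ∑ a, if a.1.1 = u ∧ (π a).1.1 = v then 1 else 0

theorem isCoupling_matchingCoupling (hle : cy ≤ cx)
    (π : BlowupX G x y cx cy ≃ BlowupY G x y cx cy) :
    IsCoupling (muX G x y cx cy) (muY G x y cy) fun u v => (matchingCoupling π u v : ℝ) := by
  classical
  refine ⟨fun u v => ?_, fun u => ?_, fun v => ?_⟩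
  · exact_mod_cast Finset.sum_nonneg fun a _ => by split_ifs <;> norm_num
  -- Testing against the indicator of `u` counts its copies; inserting `u` covers the case where it
  -- is not a neighbour.
  · have h := sum_blowupX (y := y) hle (Finset.subset_insert u (G.neighborFinset x))
      fun w => if w = u then (1 : ℝ) else 0
    simp only [ite_mul, one_mul, zero_mul, Finset.sum_ite_eq', Finset.mem_insert_self,
      if_true] at h
    rw [← h]
    simp only [matchingCoupling, Int.cast_sum, Int.cast_ite, Int.cast_one, Int.cast_zero]
    refine hasSum_sum fun a _ => ?_
    by_cases ha : a.1.1 = u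
    · simpa [ha, eq_comm] using hasSum_ite_eq (π a).1.1 (1 : ℝ)
    · simp [ha]
  · have h := sum_blowupY (cx := cx) (cy := cy)
      (Finset.subset_insert v (privateNbhd G x y)) fun w => if w = v then (1 : ℝ) else 0
    simp only [ite_mul, one_mul, zero_mul, Finset.sum_ite_eq', Finset.mem_insert_self,
      if_true] at h
    rw [← h, ← Equiv.sum_comp π]
    simp only [matchingCoupling, Int.cast_sum, Int.cast_ite, Int.cast_one, Int.cast_zero]
    refine hasSum_sum fun a _ => ?_
    by_cases ha : (π a).1.1 = v
    · simpa [ha, eq_comm] using hasSum_ite_eq a.1.1 (1 : ℝ)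
    · simp [ha]

theorem cost_matchingCoupling (π : BlowupX G x y cx cy ≃ BlowupY G x y cx cy) :
    cost G (fun u v => (matchingCoupling π u v : ℝ)) =
      ∑ a, (G.dist a.1.1 (π a).1.1 : ℝ) := by
  classical
  refine HasSum.tsum_eq ?_
  simp only [matchingCoupling, Int.cast_sum, Int.cast_ite, Int.cast_one, Int.cast_zero,
    Finset.sum_mul]
  refine hasSum_sum fun a _ => ?_
  convert hasSum_single (a.1.1, (π a).1.1) _ using 1
  · simp
  · rintro ⟨u, v⟩ h
    rw [if_neg, zero_mul]
    rintro ⟨rfl, rfl⟩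
    exact h rfl

/-- The perfect matching of the blow-up graph given by a bijection. -/
def matchingSubgraph (π : BlowupX G x y cx cy ≃ BlowupY G x y cx cy) :
    (blowupGraph G x y cx cy).Subgraph where
  verts := Set.univ
  Adj
    | .inl a, .inr b => π a = b
    | .inr b, .inl a => π a = b
    | _, _ => False
  adj_sub {v w} h := by
    rcases v with a | b <;> rcases w with a' | b' <;> simp_all
  edge_vert _ := Set.mem_univ _
  symm := ⟨fun v w h => by rcases v with a | b <;> rcases w with a' | b' <;> exact h⟩

theorem isPerfectMatching_matchingSubgraph (π : BlowupX G x y cx cy ≃ BlowupY G x y cx cy) :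
    (matchingSubgraph π).IsPerfectMatching := by
  rw [SimpleGraph.Subgraph.isPerfectMatching_iff]
  rintro (a | b)
  · refine ⟨.inr (π a), rfl, ?_⟩
    rintro (a' | b') h
    · exact h.elim
    · exact congrArg Sum.inr (Eq.symm h)
  · refine ⟨.inl (π.symm b), π.apply_symm_apply b, ?_⟩
    rintro (a' | b') h
    · exact congrArg Sum.inl ((Equiv.eq_symm_apply π).2 h)
    · exact h.elim

theorem weight_matchingSubgraph (π : BlowupX G x y cx cy ≃ BlowupY G x y cx cy) :
    weight G x y cx cy (matchingSubgraph π) = ∑ a, (G.dist a.1.1 (π a).1.1 : ℝ) := by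
  refine Finset.sum_congr rfl fun a _ => ?_
  rw [Finset.sum_eq_single (π a)]
  · exact if_pos rfl
  · exact fun b _ hb => if_neg fun h => hb (Eq.symm h)
  · simp

/-- Weak duality for perfect matchings of the blow-up graph. -/
theorem sum_potential_le_weight {M : (blowupGraph G x y cx cy).Subgraph}
    (hM : M.IsPerfectMatching) {f : V → ℝ}
    (hf : ∀ (a : BlowupX G x y cx cy) (b : BlowupY G x y cx cy),
      f a.1.1 - f b.1.1 ≤ G.dist a.1.1 b.1.1) :
    ∑ a : BlowupX G x y cx cy, f a.1.1 - ∑ b : BlowupY G x y cx cy, f b.1.1 ≤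
      weight G x y cx cy M := by
  classical
  rw [SimpleGraph.Subgraph.isPerfectMatching_iff] at hM
  -- Each vertex has exactly one partner, so its potential can be charged to its edge in `M`.
  have hX : ∀ a, ∑ b, (if M.Adj (.inl a) (.inr b) then f a.1.1 else 0) = f a.1.1 := fun a => by
    obtain ⟨w, hw, huniq⟩ := hM (.inl a)
    rcases w with a' | b
    · simpa using M.adj_sub hw
    · rw [Finset.sum_eq_single b, if_pos hw]
      · exact fun b' _ hb' => if_neg fun h => hb' (Sum.inr_injective (huniq _ h))
      · simp
  have hY : ∀ b, ∑ a, (if M.Adj (.inl a) (.inr b) then f b.1.1 else 0) = f b.1.1 := fun b => by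
    obtain ⟨w, hw, huniq⟩ := hM (.inr b)
    rcases w with a | b'
    · rw [Finset.sum_eq_single a, if_pos hw.symm]
      · exact fun a' _ ha' => if_neg fun h => ha' (Sum.inl_injective (huniq _ h.symm))
      · simp
    · simpa using M.adj_sub hw
  rw [← Finset.sum_congr rfl fun a _ => hX a, ← Finset.sum_congr rfl fun b _ => hY b,
    Finset.sum_comm (γ := BlowupY G x y cx cy) (s := Finset.univ) (t := Finset.univ)
      (f := fun b a => if M.Adj (.inl a) (.inr b) then f b.1.1 else 0),
    ← Finset.sum_sub_distrib]
  refine Finset.sum_le_sum fun a _ => ?_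
  rw [← Finset.sum_sub_distrib]
  refine Finset.sum_le_sum fun b _ => ?_
  split_ifs
  · exact hf a b
  · simp

end LLY

/-! ### Decomposition of the lazy walks. -/

namespace LLY

variable {V : Type*} {G : SimpleGraph V} {x y : V} {cx cy : ℕ}

open Classical in
/-- The mass `c_y` on `x`, `y` and their common neighbours, which stays in place. -/
noncomputable def stationaryMass (G : SimpleGraph V) (x y : V) (cy : ℕ) (u : V) : ℝ :=
  if u = x ∨ u = y ∨ (G.Adj x u ∧ G.Adj y u) then (cy : ℝ) else 0

theorem stationaryMass_nonneg (u : V) : 0 ≤ stationaryMass G x y cy u := by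
  rw [stationaryMass]; positivity

variable [G.LocallyFinite]

open Classical in
theorem muX_add_stationaryMass (hxy : G.Adj x y) (u : V) :
    muX G x y cx cy u + stationaryMass G x y cy u =
      (if G.Adj x u then (cx : ℝ) else 0) + if u = x then (cy : ℝ) else 0 := by
  by_cases hux : u = x
  · subst hux; simp [muX, stationaryMass]
  by_cases huy : u = y
  · subst huy; simp [muX, stationaryMass, mem_closedNbhd, hxy, hux]
  by_cases h1 : G.Adj x u <;> by_cases h2 : G.Adj y u <;>
    simp [muX, stationaryMass, mem_closedNbhd, h1, h2, hux, huy]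

open Classical in
theorem muY_add_stationaryMass (hxy : G.Adj x y) (u : V) :
    muY G x y cy u + stationaryMass G x y cy u =
      (if G.Adj y u then (cy : ℝ) else 0) + if u = y then (cy : ℝ) else 0 := by
  by_cases hux : u = x
  · subst hux; simp [muY, stationaryMass, mem_privateNbhd, hxy.symm, hxy.ne]
  by_cases huy : u = y
  · subst huy; simp [muY, stationaryMass, mem_privateNbhd]
  by_cases h1 : G.Adj x u <;> by_cases h2 : G.Adj y u <;>
    simp [muY, stationaryMass, mem_privateNbhd, h1, h2, hux, huy]

open Classical in
theorem sum_ite_adj {S : Finset V} {v : V} (hS : G.neighborFinset v ⊆ S) (c : ℝ) :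
    ∑ u ∈ S, (if G.Adj v u then c else 0) = c * G.degree v := by
  rw [← Finset.sum_filter, Finset.sum_const, nsmul_eq_mul, mul_comm, ← G.card_neighborFinset_eq_degree]
  congr 3
  ext u
  simp only [Finset.mem_filter, SimpleGraph.mem_neighborFinset, and_iff_right_iff_imp]
  exact fun h => hS ((G.mem_neighborFinset v u).2 h)

/-- Adding the same stationary mass to both sides gives totals `cx * d_x + cy` and `cy * d_y + cy`,
which agree. -/
theorem card_blowupX_eq (hxy : G.Adj x y) (hle : cy ≤ cx)
    (h : cx * G.degree x = cy * G.degree y) :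
    Fintype.card (BlowupX G x y cx cy) = Fintype.card (BlowupY G x y cx cy) := by
  classical
  let S := closedNbhd G x ∪ closedNbhd G y
  have hx : G.neighborFinset x ⊆ S := fun u hu => by simp_all [S, mem_closedNbhd]
  have hy : G.neighborFinset y ⊆ S := fun u hu => by simp_all [S, mem_closedNbhd]
  have hX := sum_blowupX (y := y) hle hx fun _ => 1
  have hY := sum_blowupY (cx := cx) (cy := cy) (x := x) (Finset.sdiff_subset.trans hy) fun _ => 1
  have hX' := Finset.sum_congr (rfl : S = S) fun u _ =>
    muX_add_stationaryMass (cx := cx) (cy := cy) hxy u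
  have hY' := Finset.sum_congr (rfl : S = S) fun u _ => muY_add_stationaryMass (cy := cy) hxy u
  simp only [Finset.sum_add_distrib, sum_ite_adj hx, sum_ite_adj hy] at hX' hY'
  rw [Finset.sum_ite_eq', if_pos (by simp [S, mem_closedNbhd])] at hX' hY'
  simp only [Finset.sum_const, Finset.card_univ, nsmul_eq_mul, mul_one, one_mul] at hX hY
  have h' : (cx : ℝ) * G.degree x = cy * G.degree y := by exact_mod_cast h
  have : (Fintype.card (BlowupX G x y cx cy) : ℝ) = Fintype.card (BlowupY G x y cx cy) := by
    linarith
  exact_mod_cast this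

open Classical in
theorem lazyWalk_fst (hxy : G.Adj x y) {L : ℝ} (hL : L ≠ 0) (h : L = cx * G.degree x)
    (α : ℝ) (u : V) :
    lazyWalk G α x u = (1 - α) / L * (muX G x y cx cy u + stationaryMass G x y cy u) +
      (α - (1 - α) / L * cy) * if u = x then 1 else 0 := by
  rw [muX_add_stationaryMass hxy, lazyWalk]
  have h1 : (cx : ℝ) ≠ 0 := fun h0 => hL (by rw [h, h0, zero_mul])
  have h2 : (G.degree x : ℝ) ≠ 0 := fun h0 => hL (by rw [h, h0, mul_zero])
  by_cases hu : u = x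
  · subst hu; simp
  · by_cases ha : G.Adj x u
    · simp only [hu, ha, if_true, if_false, h]; field_simp; ring
    · simp [hu, ha]

open Classical in
theorem lazyWalk_snd (hxy : G.Adj x y) {L : ℝ} (hL : L ≠ 0) (h : L = cy * G.degree y)
    (α : ℝ) (u : V) :
    lazyWalk G α y u = (1 - α) / L * (muY G x y cy u + stationaryMass G x y cy u) +
      (α - (1 - α) / L * cy) * if u = y then 1 else 0 := by
  rw [muY_add_stationaryMass hxy, lazyWalk]
  have h1 : (cy : ℝ) ≠ 0 := fun h0 => hL (by rw [h, h0, zero_mul])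
  have h2 : (G.degree y : ℝ) ≠ 0 := fun h0 => hL (by rw [h, h0, mul_zero])
  by_cases hu : u = y
  · subst hu; simp
  · by_cases ha : G.Adj y u
    · simp only [hu, ha, if_true, if_false, h]; field_simp; ring
    · simp [hu, ha]

/-- If an optimal coupling of `μ_x` and `μ_y` is certified by a potential with gradient `1` along
the edge `xy`, then it extends to an optimal coupling of lazy random walks. -/
theorem transportDist_lazyWalk (hxy : G.Adj x y) {L : ℝ} (hL : 0 < L)
    (hLx : L = cx * G.degree x) (hLy : L = cy * G.degree y) {A : V → V → ℝ}
    (hA : IsCoupling (muX G x y cx cy) (muY G x y cy) A) {S : Finset V}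
    (hx : closedNbhd G x ⊆ S) (hy : closedNbhd G y ⊆ S) {f : V → ℝ}
    (hf : ∀ u ∈ S, ∀ v ∈ S, f u - f v ≤ G.dist u v) (hfxy : f x - f y = 1)
    (hopt : cost G A = ∑ u ∈ S, f u * muX G x y cx cy u - ∑ u ∈ S, f u * muY G x y cy u)
    {α : ℝ} (hα : α ≤ 1) (hα' : (1 - α) / L * cy ≤ α) :
    transportDist G (lazyWalk G α x) (lazyWalk G α y) =
      (1 - α) / L * cost G A + (α - (1 - α) / L * cy) := by
  classical
  set t := (1 - α) / L with ht
  set s := α - t * cy with hs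
  have ht0 : 0 ≤ t := div_nonneg (by linarith) hL.le
  -- This is where `α` must be large: the mass sent from `x` to `y` cannot be negative.
  have hs0 : 0 ≤ s := by linarith
  have hzero : ∀ {v u}, closedNbhd G v ⊆ S → u ∉ S → lazyWalk G α v u = 0 := by
    intro v u hv hu
    have := not_or.1 fun h => hu (hv (mem_closedNbhd.2 h))
    simp [lazyWalk, this.1, this.2]
  have hxS : x ∈ S := hx (mem_closedNbhd.2 (.inl rfl))
  have hyS : y ∈ S := hy (mem_closedNbhd.2 (.inl rfl))
  refine IsLeast.csInf_eq ⟨⟨fun u v => t * A u v +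
    t * (if v = u then stationaryMass G x y cy u else 0) +
    s * (if u = x ∧ v = y then 1 else 0), ⟨fun u v => ?_, fun u => ?_, fun v => ?_⟩, ?_⟩, ?_⟩
  · have := hA.nonneg u v
    have := stationaryMass_nonneg (G := G) (x := x) (y := y) (cy := cy) u
    positivity
  · rw [lazyWalk_fst hxy hL.ne' hLx, mul_add]
    refine (((hA.fst u).mul_left t).add ((hasSum_ite_eq u _).mul_left t)).add
      (HasSum.mul_left s ?_)
    by_cases hu : u = x
    · simpa [hu] using hasSum_ite_eq y (1 : ℝ)
    · simp [hu]
  · rw [lazyWalk_snd hxy hL.ne' hLy, mul_add]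
    refine (((hA.snd v).mul_left t).add (HasSum.mul_left t ?_)).add (HasSum.mul_left s ?_)
    · refine (congrArg (fun F => HasSum F _) (funext fun u => ?_)).mp (hasSum_ite_eq v (stationaryMass G x y cy v))
      split_ifs <;> simp_all
    · by_cases hv : v = y
      · simpa [hv] using hasSum_ite_eq x (1 : ℝ)
      · simp [hv]
  · have h1 : HasSum (fun p : V × V => A p.1 p.2 * (G.dist p.1 p.2 : ℝ)) (cost G A) :=
      hA.hasSum_cost (S := S)
        (fun u hu => muX_eq_zero fun h => hu (hx (by simp_all [mem_closedNbhd])))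
        (fun u hu => muY_eq_zero fun h =>
          hu (hy (mem_closedNbhd.2 (.inr (mem_privateNbhd.1 h).1))))
    have h2 : HasSum (fun p : V × V => (if p = (x, y) then (1 : ℝ) else 0)) 1 :=
      hasSum_ite_eq _ _
    refine (HasSum.tsum_eq ?_).symm
    have h3 := (h1.mul_left t).add (h2.mul_left s)
    rw [mul_one] at h3
    refine (congrArg (fun F => HasSum F _) (funext ?_)).mp h3
    rintro ⟨u, v⟩
    have hd : G.dist x y = 1 := SimpleGraph.dist_eq_one_iff_adj.2 hxy
    have e1 : (if v = u then stationaryMass G x y cy u else 0) * (G.dist u v : ℝ) = 0 := by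
      split_ifs with h
      · simp [h]
      · simp
    have e2 : (if u = x ∧ v = y then (1 : ℝ) else 0) * (G.dist u v : ℝ) =
        if (u, v) = (x, y) then (1 : ℝ) else 0 := by
      simp only [Prod.mk.injEq]
      split_ifs with h
      · simp [h.1, h.2, hd]
      · simp
    dsimp only
    rw [← e2]
    linear_combination -t * e1
  · rintro _ ⟨B, hB, rfl⟩
    refine le_trans (le_of_eq ?_)
      (hB.sum_potential_le_cost (fun u => hzero hx) (fun u => hzero hy) hf)
    have key : ∀ (m : V → ℝ) (z : V), z ∈ S →
        ∑ u ∈ S, f u * (t * (m u + stationaryMass G x y cy u) + s * if u = z then 1 else 0) =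
        t * ∑ u ∈ S, f u * m u + t * ∑ u ∈ S, f u * stationaryMass G x y cy u + s * f z := by
      intro m z hz
      have : f z = ∑ u ∈ S, f u * if u = z then 1 else 0 := by simp [hz]
      rw [this, Finset.mul_sum, Finset.mul_sum, Finset.mul_sum, ← Finset.sum_add_distrib,
        ← Finset.sum_add_distrib]
      exact Finset.sum_congr rfl fun u _ => by ring
    simp_rw [lazyWalk_fst (cy := cy) hxy hL.ne' hLx, lazyWalk_snd hxy hL.ne' hLy]
    rw [key _ x hxS, key _ y hyS, hopt]
    -- The stationary terms cancel, leaving `s * (f x - f y) = s`.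
    linear_combination (-s) * hfxy

end LLY

/-! ### The curvature formula. -/

theorem theorem4 {V : Type*} (G : SimpleGraph V) [G.LocallyFinite] (x y : V)
    (hxy : G.Adj x y) (hdeg : G.degree x ≤ G.degree y)
    (cx cy : ℕ) (hc : Nat.Coprime cx cy)
    (hcx : Nat.lcm (G.degree x) (G.degree y) = cx * G.degree x)
    (hcy : Nat.lcm (G.degree x) (G.degree y) = cy * G.degree y) :
    Tendsto (fun α : ℝ => LLY.alphaCurvature G α x y / (1 - α)) (𝓝[<] (1 : ℝ))
        (𝓝 (LLY.curvature G x y)) ∧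
      ∃ C : ℝ,
        IsLeast {c : ℝ | ∃ σ : V → V → ℤ,
          LLY.IsCoupling (LLY.muX G x y cx cy) (LLY.muY G x y cy) (fun u v => (σ u v : ℝ)) ∧
          c = LLY.cost G (fun u v => (σ u v : ℝ))} C ∧
        IsLeast {c : ℝ | ∃ M : (LLY.blowupGraph G x y cx cy).Subgraph,
          M.IsPerfectMatching ∧ c = LLY.weight G x y cx cy M} C ∧
        LLY.curvature G x y =
          1 + 1 / (G.degree y : ℝ) - C / (Nat.lcm (G.degree x) (G.degree y) : ℝ) := by
  classical
  have hdx : 0 < G.degree x := (G.degree_pos_iff_exists_adj x).2 ⟨y, hxy⟩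
  have hdy : 0 < G.degree y := (G.degree_pos_iff_exists_adj y).2 ⟨x, hxy.symm⟩
  have hle : cy ≤ cx := by
    refine Nat.le_of_mul_le_mul_right ?_ hdx
    calc cy * G.degree x ≤ cy * G.degree y := Nat.mul_le_mul_left _ hdeg
      _ = cx * G.degree x := hcy.symm.trans hcx
  obtain ⟨π, f, hf, hfxy, hπ⟩ := LLY.exists_equiv_lipschitz_potential hxy
    (LLY.card_blowupX_eq hxy hle (hcx.symm.trans hcy))
  let S := LLY.closedNbhd G x ∪ LLY.closedNbhd G y
  have hreach : ∀ u ∈ S, G.Reachable x u := by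
    intro u hu
    rcases Finset.mem_union.1 hu with h | h <;> rcases LLY.mem_closedNbhd.1 h with rfl | h
    · rfl
    · exact h.reachable
    · exact hxy.reachable
    · exact hxy.reachable.trans h.reachable
  have hx : G.neighborFinset x ⊆ S := fun u hu => by simp_all [S, LLY.mem_closedNbhd]
  have hy : LLY.privateNbhd G x y ⊆ S := fun u hu =>
    Finset.mem_union_right _ (LLY.mem_closedNbhd.2 (.inr (LLY.mem_privateNbhd.1 hu).1))
  have hfS : ∀ u ∈ S, ∀ v ∈ S, f u - f v ≤ G.dist u v := fun u hu v hv =>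
    hf u v (hreach u hu) (hreach v hv)
  set C : ℝ := ∑ a, (G.dist a.1.1 (π a).1.1 : ℝ) with hC
  have hCf : C = ∑ a : LLY.BlowupX G x y cx cy, f a.1.1 -
      ∑ b : LLY.BlowupY G x y cx cy, f b.1.1 := by
    rw [← Equiv.sum_comp π fun b => f b.1.1, ← Finset.sum_sub_distrib]
    exact Finset.sum_congr rfl fun a _ => (hπ a).symm
  have hCμ : C = ∑ u ∈ S, f u * LLY.muX G x y cx cy u - ∑ u ∈ S, f u * LLY.muY G x y cy u := by
    rw [hCf, LLY.sum_blowupX hle hx, LLY.sum_blowupY hy]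
  have hσ := LLY.isCoupling_matchingCoupling hle π
  have hcost := LLY.cost_matchingCoupling π
  set L : ℝ := (Nat.lcm (G.degree x) (G.degree y) : ℝ) with hLdef
  have hL : 0 < L := Nat.cast_pos.2 (Nat.lcm_pos hdx hdy)
  have hLx : L = cx * G.degree x := by rw [hLdef, hcx]; push_cast; rfl
  have hLy : L = cy * G.degree y := by rw [hLdef, hcy]; push_cast; rfl
  have hdy' : (1 : ℝ) ≤ G.degree y := by exact_mod_cast hdy
  have hcyL : (cy : ℝ) / L = 1 / G.degree y := by
    rw [div_eq_div_iff hL.ne' (by linarith), one_mul, hLy]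
  have hlim : Tendsto (fun α : ℝ => LLY.alphaCurvature G α x y / (1 - α)) (𝓝[<] (1 : ℝ))
      (𝓝 (1 + 1 / (G.degree y : ℝ) - C / L)) := by
    refine tendsto_const_nhds.congr' ?_
    -- Since `cy / L = 1 / d_y ≤ 1`, having `α > 1/2` ensures `(1 - α) * cy / L ≤ α`.
    filter_upwards [Ioo_mem_nhdsLT (show (1 / 2 : ℝ) < 1 by norm_num)] with α hα
    have hα1 : 0 < 1 - α := by linarith [hα.2]
    have hstay : (1 - α) / L * cy ≤ α := by
      rw [div_mul_eq_mul_div, mul_div_assoc, hcyL]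
      have : 1 / (G.degree y : ℝ) ≤ 1 := by rw [div_le_one (by linarith)]; exact hdy'
      nlinarith [hα.1]
    rw [LLY.alphaCurvature, LLY.transportDist_lazyWalk hxy hL hLx hLy hσ
      Finset.subset_union_left Finset.subset_union_right hfS hfxy (hcost.trans hCμ) hα.2.le hstay,
      hcost, SimpleGraph.dist_eq_one_iff_adj.2 hxy, ← hcyL]
    field_simp
    ring
  have hcurv : LLY.curvature G x y = 1 + 1 / (G.degree y : ℝ) - C / L := hlim.limUnder_eq
  refine ⟨hcurv ▸ hlim, C, ⟨⟨_, hσ, hcost.symm⟩, ?_⟩,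
    ⟨⟨_, LLY.isPerfectMatching_matchingSubgraph π, (LLY.weight_matchingSubgraph π).symm⟩, ?_⟩,
    hcurv⟩
  · rintro _ ⟨τ, hτ, rfl⟩
    rw [hCμ]
    exact hτ.sum_potential_le_cost (fun u hu => LLY.muX_eq_zero fun h => hu (hx h))
      (fun u hu => LLY.muY_eq_zero fun h => hu (hy h)) hfS
  · rintro _ ⟨M, hM, rfl⟩
    rw [hCf]
    exact LLY.sum_potential_le_weight hM fun a b => hfS _ (hx a.1.2) _ (hy b.1.2)
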